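/- Let $n\ge 3$ be an integer and $0<m<\frac{n-2}{n}$. For $\rho_1>0$ and $\beta>0$ put $$\alpha=\frac{2\beta+\rho_1}{1-m},\qquad \beta_1=\frac{\rho_1}{n-2-nm},\qquad C_*=\frac{2m(n-2-nm)}{(1-m)\rho_1},$$ $$\beta_0=\begin{cases}\rho_1\sqrt{\frac{2(1-m)}{n-2-nm}} & \text{if } 0<m\le\frac{n-2}{n+2},\\[4pt] \rho_1\max\left(2\sqrt{\frac{2(1-m)}{n-2-nm}},\ \frac{(n+2)m-(n-2)}{n-2-nm}\right) & \text{if } \frac{n-2}{n+2}<m<\frac{n-2}{n},\end{cases}$$ $$A(\beta)=n-2-(n+2)m+\frac{2\beta(n-2-nm)}{\rho_1},$$ and $$\gamma_1=\frac{1}{2(1-m)}\left\{A(\beta)-\sqrt{A(\beta)^2-8(n-2-nm)(1-m)}\right\},$$ which for $\beta\ge\beta_0$ is the smaller root of $$\gamma^2-\frac{A(\beta)}{1-m}\,\gamma+\frac{2(n-2-nm)}{1-m}=0 .$$ Then there is a constant $\kappa>0$ depending only on $n$ and $m$ such that for every $\rho_1>0$ the number $\beta_2=\kappa\rho_1$ satisfies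 $\beta_2\ge\max(\beta_0,\beta_1)$ and the following holds. For every $\lambda>0$ and every $\beta>\beta_2$, if $g_\lambda$ is a radially symmetric positive classical ($C^2$) solution of $$\Delta v^m+\alpha v+\beta\, x\cdot\nabla v=0\quad\text{in }\mathbb{R}^n\setminus\{0\}$$ with $$\lim_{|x|\to 0}|x|^{\alpha/\beta}g_\lambda(x)=\lambda^{-\frac{\rho_1}{(1-m)\beta}},$$ then there is a constant $B>0$ such that $$g_\lambda(x)=\left(\frac{C_*}{|x|^2}\right)^{\frac{1}{1-m}}\left(1+B|x|^{-\gamma_1}+o(|x|^{-\gamma_1})\right)\quad\text{as }|x|\to\infty .$$ -/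

import Mathlib

open Filter Topology Asymptotics

noncomputable section

namespace FastDiffusion

/-- The exponent `α = (2β + ρ₁) / (1 - m)`. -/
def alpha (m ρ₁ β : ℝ) : ℝ := (2 * β + ρ₁) / (1 - m)

/-- The threshold `β₁ = ρ₁ / (n - 2 - n m)`. -/
def beta1 (n : ℕ) (m ρ₁ : ℝ) : ℝ := ρ₁ / (n - 2 - n * m)

/-- The threshold `β₀`, defined by cases on `m ≤ (n - 2) / (n + 2)`. -/
def beta0 (n : ℕ) (m ρ₁ : ℝ) : ℝ :=
  if m ≤ ((n : ℝ) - 2) / (n + 2) then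
    ρ₁ * Real.sqrt (2 * (1 - m) / (n - 2 - n * m))
  else
    ρ₁ * max (2 * Real.sqrt (2 * (1 - m) / (n - 2 - n * m)))
      (((n + 2) * m - (n - 2)) / (n - 2 - n * m))

/-- `A(β) = n - 2 - (n + 2) m + 2 β (n - 2 - n m) / ρ₁`. -/
def A (n : ℕ) (m ρ₁ β : ℝ) : ℝ :=
  n - 2 - (n + 2) * m + 2 * β * (n - 2 - n * m) / ρ₁

/-- The smaller root `γ₁` of
`γ² - (A(β) / (1 - m)) γ + 2 (n - 2 - n m) / (1 - m) = 0`. -/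
def gamma1 (n : ℕ) (m ρ₁ β : ℝ) : ℝ :=
  1 / (2 * (1 - m)) *
    (A n m ρ₁ β - Real.sqrt (A n m ρ₁ β ^ 2 - 8 * (n - 2 - n * m) * (1 - m)))

/-- The constant `C⁎ = 2 m (n - 2 - n m) / ((1 - m) ρ₁)`. -/
def Cstar (n : ℕ) (m ρ₁ : ℝ) : ℝ := 2 * m * (n - 2 - n * m) / ((1 - m) * ρ₁)

/-- `g` is radially symmetric on `ℝⁿ ∖ {0}`. -/
def IsRadial {n : ℕ} (g : EuclideanSpace ℝ (Fin n) → ℝ) : Prop :=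
  ∀ x y : EuclideanSpace ℝ (Fin n), x ≠ 0 → y ≠ 0 → ‖x‖ = ‖y‖ → g x = g y

/-- `g` is a classical solution of `Δ v ^ m + α v + β x · ∇ v = 0`, `v > 0`, in `ℝⁿ ∖ {0}`.
The value of `g` at the origin is irrelevant. -/
structure IsEllipticSolution {n : ℕ} (m α β : ℝ) (g : EuclideanSpace ℝ (Fin n) → ℝ) :
    Prop where
  contDiffOn : ContDiffOn ℝ 2 g {0}ᶜ
  pos : ∀ x, x ≠ 0 → 0 < g x
  equation : ∀ x, x ≠ 0 →
    Laplacian.laplacian (fun y => g y ^ m) x + α * g x + β * inner ℝ x (gradient g x) = 0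

/-- `g` is a radially symmetric solution in `ℝⁿ ∖ {0}` of the elliptic equation with
`α = (2β + ρ₁) / (1 - m)` such that
`|x| ^ (α / β) g(x) → λ ^ (-ρ₁ / ((1 - m) β))` as `|x| → 0`. -/
structure IsSingularSolution {n : ℕ} (m ρ₁ lam β : ℝ)
    (g : EuclideanSpace ℝ (Fin n) → ℝ) : Prop where
  radial : IsRadial g
  solution : IsEllipticSolution m (alpha m ρ₁ β) β g
  blowUp : Tendsto (fun x => ‖x‖ ^ (alpha m ρ₁ β / β) * g x) (𝓝[≠] 0)
    (𝓝 (lam ^ (-(ρ₁ / ((1 - m) * β)))))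

end FastDiffusion

end

/-!
Write `s = log |x|` and let `y(s) = (|x|² / C⁎) ^ (1 / (1 - m)) g(x)` be the profile of the radial
solution. Its power `f = y ^ m` solves the autonomous damped equation

  `f'' + (a + d f ^ μ) f' + b (f ^ (μ + 1) - f) = 0`,  `μ = 1 / m - 1`,

where `a` and `b > 0` depend only on `n` and `m`, while `d` is a multiple of `β / ρ₁`. The claim is
that `f` tends to the equilibrium `1` from above along the slow direction `e ^ (-γ₁ s)`, with a
non-zero coefficient (`IsOrbit.exists_tendsto`). Put `p = -f'`. If `d` is large, the following holds.

* The singularity of `g` at the origin says `f ~ K e ^ (-(b / d) s)` as `s → -∞`, and `b / d` is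
  small, so the mean value theorem for `log f` puts the orbit into the sector `0 < p < f - 1` at
  some time (`exists_entrance_time`).
* A barrier argument keeps the orbit in a sector `ε (f - 1) < p < f - 1` from then on
  (`IsOrbit.sector_invariant`). In particular `f > 1`, and `f - 1` decays exponentially.
* The slope `φ = p / (f - 1)` obeys `φ' = (φ - γ₁) (φ - γ₂) + O(f - 1)`, where `γ₂ ≥ 3` is the larger
  characteristic root. As `φ < 1`, the fast direction is excluded and `φ - γ₁` is exponentially
  small, so `log (f - 1) + γ₁ s` converges to a finite limit (`IsOrbit.exists_tendsto_of_sector`).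

The radial Laplacian is computed directly in the variable `s` (`laplacian_comp_log_norm`), which
gives the equation for `f` (`exists_isOrbit`).
The largeness required of `d` is a lower bound for `β / ρ₁` in terms of `n` and `m`, which gives `κ`.
-/

open Filter Topology Asymptotics

noncomputable section

namespace FastDiffusion

/-! ### Power inequalities -/

theorem rpow_add_one_ge_tangent {x μ : ℝ} (hx : 1 ≤ x) (hμ : 0 < μ) :
    1 + (μ + 1) * (x - 1) ≤ x ^ (μ + 1) := by
  have h := one_add_mul_self_le_rpow_one_add (s := x - 1) (by linarith) (p := μ + 1) (by linarith)
  rwa [add_sub_cancel] at h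

theorem rpow_add_one_sub_one_le {x μ : ℝ} (hx : 1 ≤ x) (hμ : 0 < μ) :
    x ^ (μ + 1) - 1 ≤ (μ + 1) * x ^ μ * (x - 1) := by
  have hx0 : 0 < x := by linarith
  have h := one_add_mul_self_le_rpow_one_add (s := x⁻¹ - 1)
    (by linarith [inv_pos.mpr hx0]) (p := μ + 1) (by linarith)
  rw [add_sub_cancel, Real.inv_rpow hx0.le] at h
  have hp : 0 < x ^ (μ + 1) := Real.rpow_pos_of_pos hx0 _
  have h2 := mul_le_mul_of_nonneg_left h hp.le
  rw [mul_inv_cancel₀ hp.ne'] at h2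
  rw [Real.rpow_add_one hx0.ne'] at h2 ⊢
  have e : x ^ μ * x * (1 + (μ + 1) * (x⁻¹ - 1)) = x ^ μ * x + (μ + 1) * (x ^ μ - x ^ μ * x) := by
    field_simp
  linarith

/-! ### Differential inequalities -/

theorem exists_lt_of_hasDerivAt_pos {X : ℝ → ℝ} {c s t : ℝ} (h : HasDerivAt X c t) (hc : 0 < c)
    (hst : s < t) : ∃ u ∈ Set.Ioo s t, X u < X t := by
  have h1 : Tendsto (slope X t) (𝓝[<] t) (𝓝 c) :=
    (hasDerivAt_iff_tendsto_slope.mp h).mono_left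
      (nhdsWithin_mono _ fun u hu => (ne_of_lt hu : u ≠ t))
  have h2 : ∀ᶠ u in 𝓝[<] t, 0 < slope X t u := h1.eventually_const_lt hc
  have h3 : ∀ᶠ u in 𝓝[<] t, u ∈ Set.Ioo s t := Ioo_mem_nhdsLT hst
  obtain ⟨u, hu, hu'⟩ := (h2.and h3).exists
  refine ⟨u, hu', ?_⟩
  rw [slope_def_field] at hu
  by_contra hcon
  push Not at hcon
  exact absurd hu (not_lt.mpr (div_nonpos_of_nonneg_of_nonpos (by linarith) (by linarith [hu'.2])))

/-- Invariance of the quadrant `X, Y > 0`: two functions that start positive stay positive if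
neither can reach zero with non-positive slope as long as both have remained non-negative. -/
theorem pos_of_barriers {X Y X' Y' : ℝ → ℝ} {s₀ : ℝ} (hX : ∀ t, HasDerivAt X (X' t) t)
    (hY : ∀ t, HasDerivAt Y (Y' t) t) (hX0 : 0 < X s₀) (hY0 : 0 < Y s₀)
    (hXb : ∀ t, s₀ ≤ t → (∀ u ∈ Set.Icc s₀ t, 0 ≤ X u ∧ 0 ≤ Y u) → X t = 0 → 0 < X' t)
    (hYb : ∀ t, s₀ ≤ t → (∀ u ∈ Set.Icc s₀ t, 0 ≤ X u ∧ 0 ≤ Y u) → Y t = 0 → 0 < Y' t) :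
    ∀ t, s₀ ≤ t → 0 < X t ∧ 0 < Y t := by
  have cX : Continuous X := continuous_iff_continuousAt.mpr fun t => (hX t).continuousAt
  have cY : Continuous Y := continuous_iff_continuousAt.mpr fun t => (hY t).continuousAt
  by_contra hcon
  push Not at hcon
  obtain ⟨T, hT, hT'⟩ := hcon
  let S : Set ℝ := {t | s₀ ≤ t ∧ min (X t) (Y t) ≤ 0}
  have hSc : IsClosed S :=
    (isClosed_le continuous_const continuous_id).inter
      (isClosed_le (cX.min cY) continuous_const)
  have hSn : S.Nonempty := by
    refine ⟨T, hT, ?_⟩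
    by_cases h : 0 < X T
    · exact (min_le_right _ _).trans (hT' h)
    · exact (min_le_left _ _).trans (not_lt.mp h)
  have hSb : BddBelow S := ⟨s₀, fun t ht => ht.1⟩
  obtain ⟨h1, h2⟩ : sInf S ∈ S := hSc.csInf_mem hSn hSb
  set t₁ := sInf S with ht₁
  have hbefore : ∀ u, s₀ ≤ u → u < t₁ → 0 < min (X u) (Y u) := fun u hu hut => by
    by_contra h
    exact absurd (csInf_le hSb (show u ∈ S from ⟨hu, not_lt.mp h⟩)) (not_le.mpr hut)
  have hlt : s₀ < t₁ := by
    rcases h1.lt_or_eq with h | h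
    · exact h
    · rw [← h] at h2
      exact absurd (lt_min hX0 hY0) (not_lt.mpr h2)
  have hend : 0 ≤ min (X t₁) (Y t₁) := by
    have hten : Tendsto (fun u => min (X u) (Y u)) (𝓝[<] t₁) (𝓝 (min (X t₁) (Y t₁))) :=
      ((cX.min cY).tendsto t₁).mono_left nhdsWithin_le_nhds
    refine ge_of_tendsto hten ?_
    filter_upwards [Ioo_mem_nhdsLT hlt] with u hu
    exact (hbefore u hu.1.le hu.2).le
  have hall : ∀ u ∈ Set.Icc s₀ t₁, 0 ≤ X u ∧ 0 ≤ Y u := fun u hu => by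
    rcases hu.2.lt_or_eq with h | h
    · exact le_min_iff.mp (hbefore u hu.1 h).le
    · rw [h]; exact le_min_iff.mp hend
  have hzero : X t₁ = 0 ∨ Y t₁ = 0 := by
    rcases min_le_iff.mp h2 with h | h
    · exact Or.inl (le_antisymm h (hall t₁ ⟨h1, le_rfl⟩).1)
    · exact Or.inr (le_antisymm h (hall t₁ ⟨h1, le_rfl⟩).2)
  rcases hzero with h | h
  · obtain ⟨u, hu, hu'⟩ := exists_lt_of_hasDerivAt_pos (hX t₁) (hXb t₁ h1 hall h) hlt
    linarith [(hall u ⟨hu.1.le, hu.2.le⟩).1]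
  · obtain ⟨u, hu, hu'⟩ := exists_lt_of_hasDerivAt_pos (hY t₁) (hYb t₁ h1 hall h) hlt
    linarith [(hall u ⟨hu.1.le, hu.2.le⟩).2]

theorem le_of_hasDerivAt_nonneg {F F' : ℝ → ℝ} {s t : ℝ} (hst : s ≤ t)
    (h : ∀ u ∈ Set.Icc s t, HasDerivAt F (F' u) u) (h0 : ∀ u ∈ Set.Icc s t, 0 ≤ F' u) :
    F s ≤ F t := by
  refine monotoneOn_of_hasDerivWithinAt_nonneg (f' := F') (convex_Icc s t)
    (fun u hu => (h u hu).continuousAt.continuousWithinAt)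
    (fun u hu => (h u (interior_subset hu)).hasDerivWithinAt)
    (fun u hu => h0 u (interior_subset hu)) ⟨le_rfl, hst⟩ ⟨hst, le_rfl⟩ hst

/-- A damped linear equation with exponentially small forcing has exponentially small solutions,
at the same rate, as long as the damping exceeds that rate by at least `1`. -/
theorem exists_exp_bound {ψ ω E : ℝ → ℝ} {s₀ ε K : ℝ}
    (hψ : ∀ s, s₀ ≤ s → HasDerivAt ψ (-ω s * ψ s + E s) s)
    (hω : ∀ s, s₀ ≤ s → 1 + ε ≤ ω s)
    (hE : ∀ s, s₀ ≤ s → |E s| ≤ K * Real.exp (-ε * s)) :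
    ∃ C, ∀ s, s₀ ≤ s → |ψ s| ≤ C * Real.exp (-ε * s) := by
  -- With `W = ψ e^{εs}`, the quantity `(W² - K²) e^s` is non-increasing.
  let V : ℝ → ℝ := fun s => ((ψ s * Real.exp (ε * s)) ^ 2 - K ^ 2) * Real.exp s
  have hexp : ∀ s, HasDerivAt (fun s => Real.exp (ε * s)) (Real.exp (ε * s) * ε) s := fun s => by
    simpa using ((hasDerivAt_id s).const_mul ε).exp
  have hV : ∀ s, s₀ ≤ s → V s ≤ V s₀ := by
    intro s hs
    have hd : ∀ u ∈ Set.Icc s₀ s, HasDerivAt (fun s => - V s)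
        (-((2 * (ψ u * Real.exp (ε * u)) * ((-ω u * ψ u + E u) * Real.exp (ε * u)
          + ψ u * (Real.exp (ε * u) * ε))) * Real.exp u
          + ((ψ u * Real.exp (ε * u)) ^ 2 - K ^ 2) * Real.exp u)) u := fun u hu => by
      have h1 := ((((hψ u hu.1).mul (hexp u)).pow 2).sub_const (K ^ 2)).mul (Real.hasDerivAt_exp u)
      refine h1.neg.congr_deriv ?_
      simp
    have := le_of_hasDerivAt_nonneg hs hd (fun u hu => ?_)
    · linarith
    · have hEu : |E u * Real.exp (ε * u)| ≤ K := by
        rw [abs_mul, abs_of_pos (Real.exp_pos _)]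
        calc |E u| * Real.exp (ε * u) ≤ K * Real.exp (-ε * u) * Real.exp (ε * u) :=
              mul_le_mul_of_nonneg_right (hE u hu.1) (Real.exp_pos _).le
          _ = K := by rw [mul_assoc, ← Real.exp_add]; simp
      have hω' := hω u hu.1
      set W := ψ u * Real.exp (ε * u)
      set G := E u * Real.exp (ε * u)
      have hG : G ^ 2 ≤ K ^ 2 := sq_le_sq' (abs_le.mp hEu).1 (abs_le.mp hEu).2
      have e : -((2 * W * ((-ω u * ψ u + E u) * Real.exp (ε * u)
          + ψ u * (Real.exp (ε * u) * ε))) * Real.exp u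
          + (W ^ 2 - K ^ 2) * Real.exp u)
          = (2 * (ω u - ε) * W ^ 2 - 2 * W * G - W ^ 2 + K ^ 2) * Real.exp u := by
        simp only [W, G]; ring
      rw [e]
      refine mul_nonneg ?_ (Real.exp_pos _).le
      nlinarith [sq_nonneg (W - G), mul_nonneg (sub_nonneg.mpr hω') (sq_nonneg W)]
  refine ⟨1 + K ^ 2 + |V s₀| * Real.exp (-s₀), fun s hs => ?_⟩
  have h1 : (ψ s * Real.exp (ε * s)) ^ 2 ≤ K ^ 2 + |V s₀| * Real.exp (-s₀) := by
    have h2 : (ψ s * Real.exp (ε * s)) ^ 2 - K ^ 2 = V s * Real.exp (-s) := by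
      simp only [V]; rw [mul_assoc, ← Real.exp_add]; simp
    have h3 : V s * Real.exp (-s) ≤ |V s₀| * Real.exp (-s₀) := by
      refine mul_le_mul ((hV s hs).trans (le_abs_self _)) ?_ (Real.exp_pos _).le (abs_nonneg _)
      exact Real.exp_le_exp.mpr (by linarith)
    linarith
  have h4 : |ψ s * Real.exp (ε * s)| ≤ 1 + K ^ 2 + |V s₀| * Real.exp (-s₀) := by
    rw [← sq_abs] at h1
    nlinarith [sq_nonneg (|ψ s * Real.exp (ε * s)| - 1), abs_nonneg (ψ s * Real.exp (ε * s))]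
  rw [abs_mul, abs_of_pos (Real.exp_pos _)] at h4
  have h5 : |ψ s| = |ψ s| * Real.exp (ε * s) * Real.exp (-ε * s) := by
    rw [mul_assoc, ← Real.exp_add]; simp
  rw [h5]
  exact mul_le_mul_of_nonneg_right h4 (Real.exp_pos _).le

theorem exists_tendsto_of_exp_bound {F ψ : ℝ → ℝ} {s₀ ε C : ℝ} (hε : 0 < ε)
    (hF : ∀ s, s₀ ≤ s → HasDerivAt F (ψ s) s)
    (hc : ∀ s, s₀ ≤ s → ContinuousAt ψ s)
    (hψ : ∀ s, s₀ ≤ s → |ψ s| ≤ C * Real.exp (-ε * s)) :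
    ∃ ℓ, Tendsto F atTop (𝓝 ℓ) := by
  refine ⟨_, MeasureTheory.tendsto_limUnder_of_hasDerivAt_of_integrableOn_Ioi (a := s₀) (f' := ψ)
    (fun s hs => hF s (le_of_lt hs)) ?_⟩
  refine MeasureTheory.Integrable.mono' ((exp_neg_integrableOn_Ioi s₀ hε).const_mul C) ?_ ?_
  · exact ContinuousOn.aestronglyMeasurable
      (fun s hs => (hc s (le_of_lt hs)).continuousWithinAt) measurableSet_Ioi
  · refine (MeasureTheory.ae_restrict_iff' measurableSet_Ioi).mpr (Eventually.of_forall fun s hs => ?_)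
    exact hψ s (le_of_lt hs)

/-! ### The phase-plane system -/

/-- Positive solutions on `ℝ` of `f'' + (a + d f ^ μ) f' + b (f ^ (μ + 1) - f) = 0`, written as a
first-order system with `p = -f'`. -/
structure IsOrbit (a b d μ : ℝ) (f p : ℝ → ℝ) : Prop where
  pos : ∀ s, 0 < f s
  deriv_f : ∀ s, HasDerivAt f (-p s) s
  deriv_p : ∀ s, HasDerivAt p (-(a + d * f s ^ μ) * p s + b * (f s ^ (μ + 1) - f s)) s

/-- No information on the derivative is needed at `-∞`: by the mean value theorem,
`f ~ K e ^ (-κ s)` forces `p / f` to come close to `κ` at some arbitrarily early time. -/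
theorem exists_entrance_time {f p : ℝ → ℝ} {κ K : ℝ} (hpos : ∀ s, 0 < f s)
    (hf : ∀ s, HasDerivAt f (-p s) s) (hκ : 0 < κ) (hκ' : κ ≤ 1 / 2) (hK : 0 < K)
    (hlim : Tendsto (fun s => f s * Real.exp (κ * s)) atBot (𝓝 K)) :
    ∃ s₀, 1 < f s₀ ∧ 0 < p s₀ ∧ p s₀ < f s₀ - 1 := by
  let h : ℝ → ℝ := fun s => Real.log (f s) + κ * s
  have hh : Tendsto h atBot (𝓝 (Real.log K)) := by
    refine ((Real.continuousAt_log hK.ne').tendsto.comp hlim).congr fun s => ?_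
    simp [h, Real.log_mul (hpos s).ne' (Real.exp_pos _).ne']
  have hd : ∀ s, HasDerivAt h (-p s / f s + κ) s := fun s =>
    (((hf s).log (hpos s).ne').add ((hasDerivAt_id s).const_mul κ)).congr_deriv (by simp)
  have hdiff : Tendsto (fun s => h s - h (s - 1)) atBot (𝓝 0) := by
    have h2 : Tendsto (fun s : ℝ => s - 1) atBot atBot :=
      tendsto_atBot_add_const_right _ (-1) tendsto_id
    simpa using hh.sub (hh.comp h2)
  have hflim : Tendsto f atBot atTop := by
    have h1 : Tendsto (fun s : ℝ => Real.exp (-(κ * s))) atBot atTop := by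
      refine Real.tendsto_exp_atTop.comp (tendsto_neg_atBot_atTop.comp ?_)
      exact tendsto_id.const_mul_atBot hκ
    refine (hlim.pos_mul_atTop hK h1).congr fun s => ?_
    rw [mul_assoc, ← Real.exp_add]; simp
  obtain ⟨S, hS⟩ := eventually_atBot.mp (hflim.eventually_gt_atTop 4)
  have hsmall : ∀ᶠ s in atBot, |h s - h (s - 1)| < κ / 2 := by
    have := hdiff.abs
    rw [abs_zero] at this
    exact this.eventually_lt_const (by linarith)
  obtain ⟨s, hs1, hs2⟩ := (hsmall.and (eventually_le_atBot S)).exists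
  obtain ⟨ξ, hξ, hξ'⟩ := exists_hasDerivAt_eq_slope h (fun s => -p s / f s + κ)
    (show s - 1 < s by linarith)
    (fun u _ => (hd u).continuousAt.continuousWithinAt) (fun u _ => hd u)
  have hfξ := hS ξ (hξ.2.le.trans hs2)
  have e : h s - h (s - 1) = κ - p ξ / f ξ := by
    have h3 : s - (s - 1) = 1 := by ring
    rw [h3, div_one] at hξ'
    rw [← hξ']; ring
  rw [e, abs_lt] at hs1
  have hp1 : 0 < p ξ / f ξ := by linarith [hs1.2]
  have hp2 : p ξ / f ξ < 3 / 4 := by linarith [hs1.1]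
  rw [div_lt_iff₀ (by linarith)] at hp2
  refine ⟨ξ, by linarith, ?_, by linarith⟩
  have := mul_pos hp1 (hpos ξ)
  rwa [div_mul_cancel₀ _ (hpos ξ).ne'] at this

namespace IsOrbit

variable {a b d μ : ℝ} {f p : ℝ → ℝ} {s₀ : ℝ}

/-- Once inside the sector `0 < p < f - 1`, the orbit stays in a sector
`ε (f - 1) < p < f - 1`. The upper edge repels the orbit because `d` is large. -/
theorem sector_invariant (h : IsOrbit a b d μ f p) (hμ : 0 < μ) (hb : 0 < b)
    (hd : 1 - a + b * (μ + 1) < d) (hd' : b * (μ + 1) ≤ d) (h1 : 1 < f s₀) (h2 : 0 < p s₀)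
    (h3 : p s₀ < f s₀ - 1) :
    ∃ ε, 0 < ε ∧ ε < 1 ∧ ∀ s, s₀ ≤ s →
      f s ≤ f s₀ ∧ 1 < f s ∧ ε * (f s - 1) < p s ∧ p s < f s - 1 := by
  have hd0 : 0 < d := lt_of_lt_of_le (by positivity) hd'
  -- `D` bounds the friction coefficient `a + d f ^ μ` as long as `f ≤ f s₀`.
  set D : ℝ := |a| + d * f s₀ ^ μ with hD
  have hDpos : 0 < D :=
    add_pos_of_nonneg_of_pos (abs_nonneg _) (mul_pos hd0 (Real.rpow_pos_of_pos (by linarith) _))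
  obtain ⟨ε, hε0, hε⟩ := exists_between
    (show 0 < min (b * μ / D) (min (p s₀ / (f s₀ - 1)) 1) from
      lt_min (by positivity) (lt_min (div_pos h2 (by linarith)) one_pos))
  have hε1 : ε < 1 := hε.trans_le ((min_le_right _ _).trans (min_le_right _ _))
  have hεD : ε * D < b * μ := (lt_div_iff₀ hDpos).mp (hε.trans_le (min_le_left _ _))
  have hεp : ε * (f s₀ - 1) < p s₀ :=
    (lt_div_iff₀ (by linarith)).mp (hε.trans_le ((min_le_right _ _).trans (min_le_left _ _)))
  have hmono : ∀ t, s₀ ≤ t →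
      (∀ u ∈ Set.Icc s₀ t, 0 ≤ f u - 1 - p u ∧ 0 ≤ p u - ε * (f u - 1)) →
      f t ≤ f s₀ ∧ 1 < f t := by
    intro t ht hu
    have hz : ∀ u ∈ Set.Icc s₀ t, 0 ≤ f u - 1 := fun u hu' => by
      obtain ⟨g1, g2⟩ := hu u hu'
      by_contra hneg
      push Not at hneg
      nlinarith
    constructor
    · have := le_of_hasDerivAt_nonneg ht (F := fun s => -f s) (F' := fun s => p s)
        (fun u _ => (h.deriv_f u).neg.congr_deriv (neg_neg _))
        (fun u hu' => by nlinarith [(hu u hu').2, hz u hu'])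
      linarith
    · have := le_of_hasDerivAt_nonneg ht (F := fun s => (f s - 1) * Real.exp s)
        (fun u _ => ((h.deriv_f u).sub_const 1).mul (Real.hasDerivAt_exp u))
        (fun u hu' => by nlinarith [(hu u hu').1, Real.exp_pos u])
      have h5 : 0 < (f t - 1) * Real.exp t :=
        lt_of_lt_of_le (mul_pos (by linarith) (Real.exp_pos _)) this
      linarith [(pos_iff_pos_of_mul_pos h5).mpr (Real.exp_pos t)]
  have key := pos_of_barriers (s₀ := s₀) (X := fun s => f s - 1 - p s)
    (Y := fun s => p s - ε * (f s - 1))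
    (fun t => ((h.deriv_f t).sub_const 1).sub (h.deriv_p t))
    (fun t => (h.deriv_p t).sub (((h.deriv_f t).sub_const 1).const_mul ε))
    (by linarith) (by linarith) ?_ ?_
  · refine ⟨ε, hε0, hε1, fun s hs => ?_⟩
    obtain ⟨g1, g2⟩ := hmono s hs fun u hu =>
      ⟨(key u hu.1).1.le, (key u hu.1).2.le⟩
    obtain ⟨g3, g4⟩ := key s hs
    exact ⟨g1, g2, by linarith, by linarith⟩
  · intro t ht hu hX
    obtain ⟨_, g2⟩ := hmono t ht hu
    have hp : p t = f t - 1 := by linarith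
    have hB := rpow_add_one_sub_one_le g2.le hμ
    have hF : 1 ≤ f t ^ μ := Real.one_le_rpow g2.le hμ.le
    have h6 : 0 < (a + d * f t ^ μ - 1 - b * ((μ + 1) * f t ^ μ)) * (f t - 1) := by
      refine mul_pos ?_ (by linarith)
      nlinarith
    rw [hp]
    nlinarith [mul_le_mul_of_nonneg_left hB hb.le]
  · intro t ht hu hY
    obtain ⟨g1, g2⟩ := hmono t ht hu
    have hp : p t = ε * (f t - 1) := by linarith
    have hB := rpow_add_one_ge_tangent g2.le hμ
    have hF : a + d * f t ^ μ ≤ D :=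
      add_le_add (le_abs_self a) (mul_le_mul_of_nonneg_left
        (Real.rpow_le_rpow (by linarith) g1 hμ.le) hd0.le)
    have h6 : 0 < (b * μ - ε * (a + d * f t ^ μ)) * (f t - 1) := by
      refine mul_pos ?_ (by linarith)
      nlinarith
    have h7 : 0 ≤ ε ^ 2 * (f t - 1) := mul_nonneg (sq_nonneg _) (by linarith)
    rw [hp]
    nlinarith [mul_le_mul_of_nonneg_left hB hb.le]

/-- In a sector `ε (f - 1) < p < f - 1` the slope `φ = p / (f - 1)` satisfies a Riccati equation
whose quadratic has roots `γ` and `a + d - γ`, up to an error `O(f - 1)`. Since `φ < 1` stays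
below the larger root, `φ → γ` exponentially fast, so `f - 1` decays exactly like
`e ^ (-γ s)`. -/
theorem exists_tendsto_of_sector (h : IsOrbit a b d μ f p) (hμ : 0 < μ) (hb : 0 < b)
    (hd0 : 0 < d) (had : 6 ≤ a + d) {γ : ℝ} (hγ : γ ^ 2 - (a + d) * γ + b * μ = 0)
    (hγ' : γ ≤ (a + d) / 2) {ε : ℝ} (hε0 : 0 < ε) (hε1 : ε < 1)
    (hs : ∀ s, s₀ ≤ s → f s ≤ f s₀ ∧ 1 < f s ∧ ε * (f s - 1) < p s ∧ p s < f s - 1) :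
    Tendsto f atTop (𝓝 1) ∧
      ∃ B, 0 < B ∧ Tendsto (fun s => (f s - 1) * Real.exp (γ * s)) atTop (𝓝 B) := by
  have hexp : ∀ c s : ℝ, HasDerivAt (fun s => Real.exp (c * s)) (Real.exp (c * s) * c) s :=
    fun c s => by simpa using ((hasDerivAt_id s).const_mul c).exp
  -- Exponential decay of `f - 1`.
  set M : ℝ := (f s₀ - 1) * Real.exp (ε * s₀) with hM
  have hdecay : ∀ s, s₀ ≤ s → f s - 1 ≤ M * Real.exp (-ε * s) := by
    intro s hs'
    have h1 := le_of_hasDerivAt_nonneg hs' (F := fun s => -((f s - 1) * Real.exp (ε * s)))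
      (fun u _ => (((h.deriv_f u).sub_const 1).mul (hexp ε u)).neg)
      (fun u hu => by nlinarith [(hs u hu.1).2.2.1, Real.exp_pos (ε * u)])
    have h2 : (f s - 1) * Real.exp (ε * s) ≤ M := by simpa using h1
    have h3 : f s - 1 = (f s - 1) * Real.exp (ε * s) * Real.exp (-ε * s) := by
      rw [mul_assoc, ← Real.exp_add]; simp
    rw [h3]
    exact mul_le_mul_of_nonneg_right h2 (Real.exp_pos _).le
  have hexp0 : Tendsto (fun s : ℝ => M * Real.exp (-ε * s)) atTop (𝓝 0) := by
    have : Tendsto (fun s : ℝ => -ε * s) atTop atBot :=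
      tendsto_id.const_mul_atTop_of_neg (by linarith)
    simpa using (Real.tendsto_exp_atBot.comp this).const_mul M
  have hf1 : Tendsto f atTop (𝓝 1) := by
    have h1 : Tendsto (fun s => f s - 1) atTop (𝓝 0) := by
      refine tendsto_of_tendsto_of_tendsto_of_le_of_le' tendsto_const_nhds hexp0 ?_ ?_
      · filter_upwards [eventually_ge_atTop s₀] with s hs'
        linarith [(hs s hs').2.1]
      · filter_upwards [eventually_ge_atTop s₀] with s hs' using hdecay s hs'
    simpa using h1.add_const 1
  refine ⟨hf1, ?_⟩
  let ψ : ℝ → ℝ := fun s => p s / (f s - 1) - γ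
  let E : ℝ → ℝ := fun s => -d * (f s ^ μ - 1) * (p s / (f s - 1))
    + b * ((f s ^ (μ + 1) - f s) / (f s - 1) - μ)
  have hψd : ∀ s, s₀ ≤ s →
      HasDerivAt ψ (-(a + d - γ - p s / (f s - 1)) * ψ s + E s) s := by
    intro s hs'
    have hz : f s - 1 ≠ 0 := by linarith [(hs s hs').2.1]
    refine (((h.deriv_p s).div ((h.deriv_f s).sub_const 1) hz).sub_const γ).congr_deriv ?_
    simp only [ψ, E]
    have e : b * μ = (a + d) * γ - γ ^ 2 := by linarith
    rw [mul_sub b _ μ, e]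
    field_simp
    ring
  have hφ : ∀ s, s₀ ≤ s → 0 < p s / (f s - 1) ∧ p s / (f s - 1) < 1 := by
    intro s hs'
    obtain ⟨_, g2, g3, g4⟩ := hs s hs'
    have hz : 0 < f s - 1 := by linarith
    exact ⟨div_pos (lt_trans (by positivity) g3) hz, (div_lt_one hz).mpr g4⟩
  set K : ℝ := (d + b * (μ + 1)) * ((μ + 1) * f s₀ ^ μ) with hK
  have hE : ∀ s, s₀ ≤ s → |E s| ≤ K * M * Real.exp (-ε * s) := by
    intro s hs'
    obtain ⟨g1, g2, _, _⟩ := hs s hs'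
    obtain ⟨k1, k2⟩ := hφ s hs'
    have hz : 0 < f s - 1 := by linarith
    have hF1 : 1 ≤ f s ^ μ := Real.one_le_rpow g2.le hμ.le
    have hB1 := rpow_add_one_ge_tangent g2.le hμ
    have hB2 := rpow_add_one_sub_one_le g2.le hμ
    have hFz : f s ^ μ - 1 ≤ (μ + 1) * f s₀ ^ μ * (f s - 1) := by
      have i1 : f s ^ μ ≤ f s ^ (μ + 1) :=
        Real.rpow_le_rpow_of_exponent_le g2.le (by linarith)
      have i2 : f s ^ μ ≤ f s₀ ^ μ := Real.rpow_le_rpow (by linarith) g1 hμ.le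
      have i3 : (μ + 1) * f s ^ μ * (f s - 1) ≤ (μ + 1) * f s₀ ^ μ * (f s - 1) := by gcongr
      linarith
    have hq0 : 0 ≤ (f s ^ (μ + 1) - f s) / (f s - 1) - μ := by
      rw [sub_nonneg, le_div_iff₀ hz]; linarith
    have hq1 : (f s ^ (μ + 1) - f s) / (f s - 1) - μ ≤ (μ + 1) * (f s ^ μ - 1) := by
      rw [sub_le_iff_le_add, div_le_iff₀ hz]; linarith
    have hE1 : |E s| ≤ (d + b * (μ + 1)) * (f s ^ μ - 1) := by
      refine (abs_add_le _ _).trans ?_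
      rw [add_mul]
      refine add_le_add ?_ ?_
      · rw [abs_mul, abs_mul, abs_neg, abs_of_pos hd0, abs_of_nonneg (sub_nonneg.mpr hF1),
          abs_of_pos k1]
        exact mul_le_of_le_one_right (mul_nonneg hd0.le (by linarith)) k2.le
      · rw [abs_mul, abs_of_pos hb, abs_of_nonneg hq0, mul_assoc]
        exact mul_le_mul_of_nonneg_left hq1 hb.le
    have hc : 0 ≤ d + b * (μ + 1) := by positivity
    have hKpos : 0 ≤ K :=
      mul_nonneg hc (mul_nonneg (by linarith) (Real.rpow_nonneg (h.pos s₀).le _))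
    calc |E s| ≤ (d + b * (μ + 1)) * (f s ^ μ - 1) := hE1
      _ ≤ (d + b * (μ + 1)) * ((μ + 1) * f s₀ ^ μ * (f s - 1)) :=
          mul_le_mul_of_nonneg_left hFz hc
      _ = K * (f s - 1) := by rw [hK]; ring
      _ ≤ K * (M * Real.exp (-ε * s)) := mul_le_mul_of_nonneg_left (hdecay s hs') hKpos
      _ = K * M * Real.exp (-ε * s) := by ring
  obtain ⟨C, hC⟩ := exists_exp_bound (ψ := ψ) hψd
    (fun s hs' => by linarith [(hφ s hs').2]) hE
  have hlog : ∀ s, s₀ ≤ s →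
      HasDerivAt (fun s => -(Real.log (f s - 1) + γ * s)) (ψ s) s := by
    intro s hs'
    have hz : f s - 1 ≠ 0 := by linarith [(hs s hs').2.1]
    refine ((((h.deriv_f s).sub_const 1).log hz).add
      ((hasDerivAt_id s).const_mul γ)).neg.congr_deriv ?_
    simp only [ψ, mul_one]
    ring
  obtain ⟨ℓ, hℓ⟩ := exists_tendsto_of_exp_bound hε0 hlog
    (fun s hs' => (hψd s hs').continuousAt) hC
  refine ⟨Real.exp (-ℓ), Real.exp_pos _, ?_⟩
  refine ((Real.continuous_exp.tendsto _).comp hℓ.neg).congr' ?_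
  filter_upwards [eventually_ge_atTop s₀] with s hs'
  have hz : 0 < f s - 1 := by linarith [(hs s hs').2.1]
  simp [Real.exp_add, Real.exp_log hz]

/-- The phase-plane form of the asymptotic expansion. -/
theorem exists_tendsto (h : IsOrbit a b d μ f p) (hμ : 0 < μ) (hb : 0 < b)
    (hd : 6 + |a| + b * (μ + 2) ≤ d) {γ : ℝ} (hγ : γ ^ 2 - (a + d) * γ + b * μ = 0)
    (hγ' : γ ≤ (a + d) / 2) {K : ℝ} (hK : 0 < K)
    (hlim : Tendsto (fun s => f s * Real.exp (b / d * s)) atBot (𝓝 K)) :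
    Tendsto f atTop (𝓝 1) ∧
      ∃ B, 0 < B ∧ Tendsto (fun s => (f s - 1) * Real.exp (γ * s)) atTop (𝓝 B) := by
  have ha1 := neg_abs_le a
  have ha2 := abs_nonneg a
  have hbμ : 0 < b * μ := mul_pos hb hμ
  have hd0 : 0 < d := by linarith
  obtain ⟨s₀, h1, h2, h3⟩ := exists_entrance_time h.pos h.deriv_f (div_pos hb hd0)
    (by rw [div_le_iff₀ hd0]; linarith) hK hlim
  obtain ⟨ε, hε0, hε1, hs⟩ := h.sector_invariant hμ hb (by linarith) (by linarith) h1 h2 h3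
  exact h.exists_tendsto_of_sector hμ hb hd0 (by linarith) hγ hγ' hε0 hε1 hs

end IsOrbit

/-! ### Radial functions in the variable `log ‖x‖` -/

theorem hasFDerivAt_log_norm {V : Type*} [NormedAddCommGroup V] [InnerProductSpace ℝ V] {x : V}
    (hx : x ≠ 0) :
    HasFDerivAt (fun y : V => Real.log ‖y‖)
      (Real.exp (-2 * Real.log ‖x‖) • innerSL ℝ x) x := by
  have hx' : 0 < ‖x‖ := norm_pos_iff.mpr hx
  have h1 : HasFDerivAt (fun y : V => ‖y‖ ^ 2) (2 • innerSL ℝ x) x :=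
    (hasStrictFDerivAt_norm_sq x).hasFDerivAt
  have h2 := (h1.log (by positivity)).const_mul (1 / 2 : ℝ)
  have e : Real.exp (-2 * Real.log ‖x‖) = (‖x‖ ^ 2)⁻¹ := by
    rw [show -2 * Real.log ‖x‖ = -(Real.log (‖x‖ ^ 2)) by rw [Real.log_pow]; push_cast; ring,
      Real.exp_neg, Real.exp_log (by positivity)]
  have h3 : (fun y : V => Real.log ‖y‖) = fun y : V => 1 / 2 * Real.log (‖y‖ ^ 2) := by
    funext y
    rw [Real.log_pow]; push_cast; ring
  rw [h3, e]
  refine h2.congr_fderiv ?_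
  ext v
  simp
  ring

/-- The Laplacian of `H (log ‖x‖)` is `‖x‖⁻² (H'' + (n - 2) H') (log ‖x‖)`. -/
theorem laplacian_comp_log_norm {n : ℕ} {F : EuclideanSpace ℝ (Fin n) → ℝ} {H H₁ H₂ : ℝ → ℝ}
    (hF : ∀ y, y ≠ 0 → F y = H (Real.log ‖y‖)) (hH : ∀ s, HasDerivAt H (H₁ s) s)
    (hH₁ : ∀ s, HasDerivAt H₁ (H₂ s) s) {x : EuclideanSpace ℝ (Fin n)} (hx : x ≠ 0) :
    Laplacian.laplacian F x = Real.exp (-2 * Real.log ‖x‖) *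
      (H₂ (Real.log ‖x‖) + (n - 2) * H₁ (Real.log ‖x‖)) := by
  set s := Real.log ‖x‖ with hs
  have hnhds : ∀ y : EuclideanSpace ℝ (Fin n), y ≠ 0 → ∀ᶠ z in 𝓝 y, z ≠ 0 := fun y hy =>
    isOpen_ne.mem_nhds hy
  have hfd : ∀ y : EuclideanSpace ℝ (Fin n), y ≠ 0 →
      fderiv ℝ F y =
        (H₁ (Real.log ‖y‖) * Real.exp (-2 * Real.log ‖y‖)) • innerSL ℝ y := by
    intro y hy
    have h1 := (hH (Real.log ‖y‖)).comp_hasFDerivAt y (hasFDerivAt_log_norm hy)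
    rw [mul_smul, ← h1.fderiv]
    refine Filter.EventuallyEq.fderiv_eq ?_
    filter_upwards [hnhds y hy] with z hz using hF z hz
  have hQ : HasDerivAt (fun t => H₁ t * Real.exp (-2 * t))
      ((H₂ s - 2 * H₁ s) * Real.exp (-2 * s)) s := by
    have h1 : HasDerivAt (fun t => Real.exp (-2 * t)) (Real.exp (-2 * s) * -2) s := by
      simpa using ((hasDerivAt_id s).const_mul (-2)).exp
    exact ((hH₁ s).mul h1).congr_deriv (by ring)
  have hc := hQ.comp_hasFDerivAt x (hasFDerivAt_log_norm hx)
  have hinner : HasFDerivAt (fun y : EuclideanSpace ℝ (Fin n) => innerSL ℝ y) (innerSL ℝ) x :=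
    (innerSL ℝ (E := EuclideanSpace ℝ (Fin n))).hasFDerivAt
  have hsm := hc.smul hinner
  have h2 := (hsm.congr_of_eventuallyEq (f₁ := fderiv ℝ F)
    (by filter_upwards [hnhds x hx] with z hz using hfd z hz)).fderiv
  have hbasis := (EuclideanSpace.basisFun (Fin n) ℝ).sum_sq_inner_left x
  have hexp : Real.exp (-2 * s) * ‖x‖ ^ 2 = 1 := by
    have hx' : 0 < ‖x‖ := norm_pos_iff.mpr hx
    rw [hs, show -2 * Real.log ‖x‖ = -(Real.log (‖x‖ ^ 2)) by rw [Real.log_pow]; push_cast; ring,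
      Real.exp_neg, Real.exp_log (by positivity), inv_mul_cancel₀ (by positivity)]
  rw [congrFun (InnerProductSpace.laplacian_eq_iteratedFDeriv_orthonormalBasis F
    (EuclideanSpace.basisFun (Fin n) ℝ)) x]
  have hterm : ∀ i : Fin n, iteratedFDeriv ℝ 2 F x
      ![EuclideanSpace.basisFun (Fin n) ℝ i, EuclideanSpace.basisFun (Fin n) ℝ i]
      = H₁ s * Real.exp (-2 * s) + (H₂ s - 2 * H₁ s) * Real.exp (-2 * s) * Real.exp (-2 * s) *
        inner ℝ x (EuclideanSpace.basisFun (Fin n) ℝ i) ^ 2 := by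
    intro i
    rw [iteratedFDeriv_two_apply, h2]
    have hone : inner ℝ (EuclideanSpace.basisFun (Fin n) ℝ i)
        (EuclideanSpace.basisFun (Fin n) ℝ i) = (1 : ℝ) := by
      rw [real_inner_self_eq_norm_sq, OrthonormalBasis.norm_eq_one]; norm_num
    change H₁ s * Real.exp (-2 * s) * inner ℝ (EuclideanSpace.basisFun (Fin n) ℝ i)
        (EuclideanSpace.basisFun (Fin n) ℝ i) +
      (H₂ s - 2 * H₁ s) * Real.exp (-2 * s) * (Real.exp (-2 * s) *
        inner ℝ x (EuclideanSpace.basisFun (Fin n) ℝ i)) *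
        inner ℝ x (EuclideanSpace.basisFun (Fin n) ℝ i) = _
    rw [hone]
    ring
  rw [Finset.sum_congr rfl fun i _ => hterm i, Finset.sum_add_distrib,
    ← Finset.mul_sum (f := fun i => inner ℝ x (EuclideanSpace.basisFun (Fin n) ℝ i) ^ 2), hbasis]
  simp only [Finset.sum_const, Finset.card_univ, Fintype.card_fin, nsmul_eq_mul]
  linear_combination ((H₂ s - 2 * H₁ s) * Real.exp (-2 * s)) * hexp

/-- In the variable `s = log ‖x‖` a radial solution of the elliptic equation satisfies an
ordinary differential equation. -/
theorem IsEllipticSolution.ode {n : ℕ} {m α β : ℝ} {g : EuclideanSpace ℝ (Fin n) → ℝ}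
    (hg : IsEllipticSolution m α β g) (hrad : IsRadial g) {ω : EuclideanSpace ℝ (Fin n)}
    (hω : ‖ω‖ = 1) :
    ∃ G' P₁ P₂ : ℝ → ℝ,
      (∀ s, HasDerivAt (fun s => g (Real.exp s • ω)) (G' s) s) ∧
      (∀ s, HasDerivAt (fun s => g (Real.exp s • ω) ^ m) (P₁ s) s) ∧
      (∀ s, HasDerivAt P₁ (P₂ s) s) ∧
      ∀ s, Real.exp (-2 * s) * (P₂ s + (n - 2) * P₁ s) + α * g (Real.exp s • ω)
        + β * G' s = 0 := by
  have hω0 : ω ≠ 0 := by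
    rw [← norm_pos_iff, hω]; exact one_pos
  have hne : ∀ s : ℝ, Real.exp s • ω ≠ 0 := fun s => smul_ne_zero (Real.exp_pos s).ne' hω0
  have hnorm : ∀ s : ℝ, ‖Real.exp s • ω‖ = Real.exp s := fun s => by
    rw [norm_smul, hω, Real.norm_of_nonneg (Real.exp_pos s).le, mul_one]
  have hgat : ∀ x, x ≠ 0 → ContDiffAt ℝ 2 g x := fun x hx =>
    hg.contDiffOn.contDiffAt (isOpen_compl_singleton.mem_nhds hx)
  have hGc : ContDiff ℝ 2 fun s => g (Real.exp s • ω) := contDiff_iff_contDiffAt.mpr fun s =>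
    (hgat _ (hne s)).comp s (Real.contDiff_exp.contDiffAt.smul contDiffAt_const)
  have hPc : ContDiff ℝ 2 fun s => g (Real.exp s • ω) ^ m :=
    hGc.rpow_const_of_ne fun s => (hg.pos _ (hne s)).ne'
  have hP1 : ContDiff ℝ 1 (deriv fun s => g (Real.exp s • ω) ^ m) :=
    (contDiff_succ_iff_deriv.mp (show ContDiff ℝ (1 + 1) _ from by norm_num; exact hPc)).2.2
  have hline : ∀ s, HasDerivAt (fun s => g (Real.exp s • ω))
      (fderiv ℝ g (Real.exp s • ω) (Real.exp s • ω)) s := fun s =>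
    ((hgat _ (hne s)).differentiableAt (by norm_num)).hasFDerivAt.comp_hasDerivAt s
      ((Real.hasDerivAt_exp s).smul_const ω)
  have hPd : ∀ s, HasDerivAt (fun s => g (Real.exp s • ω) ^ m)
      (deriv (fun s => g (Real.exp s • ω) ^ m) s) s := fun s =>
    (hPc.differentiable (by norm_num) s).hasDerivAt
  have hPd' : ∀ s, HasDerivAt (deriv fun s => g (Real.exp s • ω) ^ m)
      (deriv (deriv fun s => g (Real.exp s • ω) ^ m) s) s := fun s =>
    (hP1.differentiable (by norm_num) s).hasDerivAt
  refine ⟨_, _, _, hline, hPd, hPd', fun s => ?_⟩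
  have heq := hg.equation _ (hne s)
  rw [laplacian_comp_log_norm (F := fun y => g y ^ m) (H := fun s => g (Real.exp s • ω) ^ m)
    (fun y hy => ?_) hPd hPd' (hne s), hnorm, Real.log_exp] at heq
  · rwa [inner_gradient_right] at heq
  · rw [hrad y (Real.exp (Real.log ‖y‖) • ω) hy (hne _)]
    rw [hnorm, Real.exp_log (norm_pos_iff.mpr hy)]

/-! ### The normalised profile -/

/-- The profile `(|x|² / C) ^ (1 / (1 - m)) g(x)` as a function of `s = log |x|`, where `G s` is
the value of the radial function `g` on the sphere `|x| = e ^ s`. -/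
def profile (m C : ℝ) (G : ℝ → ℝ) (s : ℝ) : ℝ :=
  Real.exp (2 / (1 - m) * s) / C ^ (1 / (1 - m)) * G s

theorem profile_pos {m C : ℝ} {G : ℝ → ℝ} (hC : 0 < C) (hG : ∀ s, 0 < G s) (s : ℝ) :
    0 < profile m C G s :=
  mul_pos (div_pos (Real.exp_pos _) (Real.rpow_pos_of_pos hC _)) (hG s)

/-- The `m`-th power of the profile solves the phase-plane system. Passing to this power makes the
diffusion term linear, so the nonlinearity sits only in the friction and in the restoring force. -/
theorem exists_isOrbit {N ν m ρ β : ℝ} (hm0 : 0 < m) (hm1 : m < 1) (hρ : 0 < ρ)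
    (hN : N = ν - 2 - ν * m) (hN0 : 0 < N) {G G' P₁ P₂ : ℝ → ℝ} (hG : ∀ s, 0 < G s)
    (hG' : ∀ s, HasDerivAt G (G' s) s) (hP : ∀ s, HasDerivAt (fun s => G s ^ m) (P₁ s) s)
    (hP₁ : ∀ s, HasDerivAt P₁ (P₂ s) s)
    (hode : ∀ s, Real.exp (-2 * s) * (P₂ s + (ν - 2) * P₁ s) + alpha m ρ β * G s
      + β * G' s = 0) :
    ∃ p, IsOrbit ((ν - 2 - (ν + 2) * m) / (1 - m)) (2 * m * N / (1 - m) ^ 2)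
      (2 * β * N / (ρ * (1 - m))) (1 / m - 1)
      (fun s => profile m (2 * m * N / ((1 - m) * ρ)) G s ^ m) p := by
  have h1m : 0 < 1 - m := by linarith
  set C : ℝ := 2 * m * N / ((1 - m) * ρ) with hCdef
  have hC : 0 < C := by positivity
  set U : ℝ := C ^ (1 / (1 - m)) with hU
  have hU0 : 0 < U := Real.rpow_pos_of_pos hC _
  -- The power of `C` in the normalisation balances the diffusion and drift terms.
  have hUC : C * (U ^ m) = U := by
    rw [hU, ← Real.rpow_mul hC.le]
    nth_rewrite 1 [← Real.rpow_one C]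
    rw [← Real.rpow_add hC]
    congr 1
    field_simp
    ring
  set q : ℝ := 2 * m / (1 - m) with hq
  have hUm : 0 < U ^ m := Real.rpow_pos_of_pos hU0 _
  have hfm : ∀ s, profile m C G s ^ m = Real.exp (q * s) / U ^ m * G s ^ m := by
    intro s
    rw [profile, Real.mul_rpow (by positivity) (hG s).le,
      Real.div_rpow (Real.exp_pos _).le hU0.le, ← Real.exp_mul]
    congr 3
    rw [hq]; ring
  have hexp : ∀ s, HasDerivAt (fun s => Real.exp (q * s) / U ^ m)
      (Real.exp (q * s) * q / U ^ m) s := fun s => by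
    simpa using (((hasDerivAt_id s).const_mul q).exp).div_const (U ^ m)
  have hfun : (fun s => profile m C G s ^ m) = fun s => Real.exp (q * s) / U ^ m * G s ^ m :=
    funext hfm
  refine ⟨fun s => -(Real.exp (q * s) * q / U ^ m * G s ^ m
    + Real.exp (q * s) / U ^ m * P₁ s), fun s => Real.rpow_pos_of_pos (profile_pos hC hG s) _,
    fun s => ?_, fun s => ?_⟩
  · rw [hfun, neg_neg]
    exact (hexp s).mul (hP s)
  · have hexp' : HasDerivAt (fun s => Real.exp (q * s) * q / U ^ m)
        (Real.exp (q * s) * q * q / U ^ m) s := by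
      simpa using ((((hasDerivAt_id s).const_mul q).exp).mul_const q).div_const (U ^ m)
    have hd := ((hexp'.mul (hP s)).add ((hexp s).mul (hP₁ s))).neg
    refine hd.congr_deriv ?_
    have hPs : P₁ s = G' s * m * G s ^ (m - 1) :=
      (hP s).unique ((hG' s).rpow_const (Or.inl (hG s).ne'))
    have hGm : G s ^ (m - 1) = G s ^ m / G s := by
      rw [Real.rpow_sub_one (hG s).ne']
    have hy0 := profile_pos hC hG (m := m) s
    have hy : profile m C G s = Real.exp (q * s) * Real.exp (2 * s) / U * G s := by
      rw [profile, ← Real.exp_add]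
      congr 3
      rw [hq]; field_simp; ring
    have hpow1 : (profile m C G s ^ m) ^ (1 / m - 1 + 1) = profile m C G s := by
      rw [← Real.rpow_mul hy0.le]
      rw [show m * (1 / m - 1 + 1) = 1 by field_simp; ring, Real.rpow_one]
    have hpow : (profile m C G s ^ m) ^ (1 / m - 1) =
        profile m C G s / profile m C G s ^ m := by
      rw [eq_div_iff (Real.rpow_pos_of_pos hy0 _).ne']
      rw [← Real.rpow_add_one (Real.rpow_pos_of_pos hy0 _).ne', hpow1]
    simp only [hpow1, hpow]
    rw [hfm, hy]
    have hode' := hode s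
    have hee : Real.exp (-2 * s) * Real.exp (2 * s) = 1 := by rw [← Real.exp_add]; simp
    have hEP : P₂ s = -(ν - 2) * P₁ s
        - Real.exp (2 * s) * (alpha m ρ β * G s + β * G' s) := by
      linear_combination Real.exp (2 * s) * hode' - (P₂ s + (ν - 2) * P₁ s) * hee
    rw [hEP, hPs, hGm]
    have hgm : 0 < G s ^ m := Real.rpow_pos_of_pos (hG s) _
    have hgs := hG s
    have hes := Real.exp_pos (q * s)
    generalize U ^ m = R at hUC hUm ⊢
    rw [alpha, ← hUC, hCdef, hq]
    generalize Real.exp (2 * m / (1 - m) * s) = X at *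
    generalize G s ^ m = Q at *
    generalize G s = g at *
    generalize Real.exp (2 * s) = Z at *
    field_simp
    subst hN
    ring

/-! ### Parameters -/

theorem beta0_eq_mul (n : ℕ) (m ρ : ℝ) : beta0 n m ρ = beta0 n m 1 * ρ := by
  unfold beta0
  split_ifs <;> ring

theorem beta1_eq_mul (n : ℕ) (m ρ : ℝ) : beta1 n m ρ = beta1 n m 1 * ρ := by
  unfold beta1
  ring

theorem gamma1_isRoot {n : ℕ} {m ρ β : ℝ} (hm : m < 1)
    (hA : 8 * (n - 2 - n * m) * (1 - m) ≤ A n m ρ β ^ 2) :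
    gamma1 n m ρ β ^ 2 - A n m ρ β / (1 - m) * gamma1 n m ρ β
        + 2 * (n - 2 - n * m) / (1 - m) = 0 ∧
      gamma1 n m ρ β ≤ A n m ρ β / (1 - m) / 2 := by
  have h1m : 0 < 1 - m := by linarith
  have hs := Real.sq_sqrt (sub_nonneg.mpr hA)
  have hs0 := Real.sqrt_nonneg (A n m ρ β ^ 2 - 8 * (n - 2 - n * m) * (1 - m))
  unfold gamma1
  set S := Real.sqrt (A n m ρ β ^ 2 - 8 * (n - 2 - n * m) * (1 - m))
  constructor
  · field_simp
    linear_combination hs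
  · rw [one_div_mul_eq_div, div_div, mul_comm (1 - m) 2]
    exact div_le_div_of_nonneg_right (by linarith) (by positivity)

/-! ### Asymptotics of the solution -/

/-- The singular behaviour of `g` at the origin fixes the behaviour of the profile at `-∞`. -/
theorem IsSingularSolution.tendsto_profile_rpow {n : ℕ} {m ρ lam β C : ℝ}
    {g : EuclideanSpace ℝ (Fin n) → ℝ} (hm : m < 1) (hβ : 0 < β) (hC : 0 < C) (hlam : 0 < lam)
    (hg : IsSingularSolution m ρ lam β g) {ω : EuclideanSpace ℝ (Fin n)} (hω : ‖ω‖ = 1) :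
    ∃ K, 0 < K ∧ Tendsto (fun s => profile m C (fun s => g (Real.exp s • ω)) s ^ m *
      Real.exp (m * ρ / ((1 - m) * β) * s)) atBot (𝓝 K) := by
  have h1m : 0 < 1 - m := by linarith
  have hω0 : ω ≠ 0 := by
    rw [← norm_pos_iff, hω]; exact one_pos
  have hnorm : ∀ s : ℝ, ‖Real.exp s • ω‖ = Real.exp s := fun s => by
    rw [norm_smul, hω, Real.norm_of_nonneg (Real.exp_pos s).le, mul_one]
  have hpt : Tendsto (fun s : ℝ => Real.exp s • ω) atBot (𝓝[≠] 0) := by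
    refine tendsto_nhdsWithin_iff.mpr ⟨?_, Eventually.of_forall fun s =>
      smul_ne_zero (Real.exp_pos s).ne' hω0⟩
    simpa using Real.tendsto_exp_atBot.smul_const ω
  have hU : 0 < C ^ (1 / (1 - m)) := Real.rpow_pos_of_pos hC _
  have hL : 0 < lam ^ (-(ρ / ((1 - m) * β))) := Real.rpow_pos_of_pos hlam _
  have h1 := ((hg.blowUp.comp hpt).div_const (C ^ (1 / (1 - m)))).rpow_const
    (p := m) (Or.inl (div_pos hL hU).ne')
  refine ⟨_, Real.rpow_pos_of_pos (div_pos hL hU) m, h1.congr fun s => ?_⟩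
  have hGs : 0 < g (Real.exp s • ω) :=
    hg.solution.pos _ (smul_ne_zero (Real.exp_pos s).ne' hω0)
  simp only [Function.comp_apply, hnorm]
  have e : Real.exp (m * ρ / ((1 - m) * β) * s) = Real.exp (ρ / ((1 - m) * β) * s) ^ m := by
    rw [← Real.exp_mul]; congr 1; ring
  rw [e, ← Real.mul_rpow (profile_pos hC (fun s => hg.solution.pos _
    (smul_ne_zero (Real.exp_pos s).ne' hω0)) s).le (Real.exp_pos _).le]
  congr 1
  have e2 : Real.exp s ^ (alpha m ρ β / β) =
      Real.exp (2 / (1 - m) * s) * Real.exp (ρ / ((1 - m) * β) * s) := by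
    rw [← Real.exp_mul, ← Real.exp_add, alpha]
    congr 1
    field_simp
  rw [e2]
  simp only [profile]
  ring

/-- A power of a function that tends to `1` at a given rate does so at the same rate. -/
theorem tendsto_rpow_sub_one_mul {f w : ℝ → ℝ} {B r : ℝ} (hf : Tendsto f atTop (𝓝 1))
    (h : Tendsto (fun s => (f s - 1) * w s) atTop (𝓝 B)) :
    Tendsto (fun s => (f s ^ r - 1) * w s) atTop (𝓝 (r * B)) := by
  have hd : HasDerivAt (fun x : ℝ => x ^ r) r 1 := by
    simpa using Real.hasDerivAt_rpow_const (x := 1) (p := r) (Or.inl one_ne_zero)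
  have hc := (continuousAt_dslope_same.mpr hd.differentiableAt).tendsto.comp hf
  rw [dslope_same, hd.deriv] at hc
  refine (hc.mul h).congr fun s => ?_
  have := sub_smul_dslope (fun x : ℝ => x ^ r) 1 (f s)
  rw [Real.one_rpow, smul_eq_mul] at this
  rw [← this, Function.comp_apply]
  ring

/-- Convergence of the profile at rate `e ^ (-γ s)` is an expansion of `g` at infinity. -/
theorem exists_expansion_of_tendsto_profile {n : ℕ} {m C γ B : ℝ}
    {g : EuclideanSpace ℝ (Fin n) → ℝ} (hm : m < 1) (hC : 0 < C) (hrad : IsRadial g)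
    {ω : EuclideanSpace ℝ (Fin n)} (hω : ‖ω‖ = 1)
    (h : Tendsto (fun s => (profile m C (fun s => g (Real.exp s • ω)) s - 1) *
      Real.exp (γ * s)) atTop (𝓝 B)) :
    ∃ e : EuclideanSpace ℝ (Fin n) → ℝ,
      e =o[Bornology.cobounded (EuclideanSpace ℝ (Fin n))] (fun x => ‖x‖ ^ (-γ)) ∧
      ∀ x : EuclideanSpace ℝ (Fin n), x ≠ 0 →
        g x = (C / ‖x‖ ^ 2) ^ (1 / (1 - m)) * (1 + B * ‖x‖ ^ (-γ) + e x) := by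
  have h1m : 0 < 1 - m := by linarith
  have hω0 : ω ≠ 0 := by
    rw [← norm_pos_iff, hω]; exact one_pos
  refine ⟨fun x => profile m C (fun s => g (Real.exp s • ω)) (Real.log ‖x‖) - 1
    - B * ‖x‖ ^ (-γ), ?_, fun x hx => ?_⟩
  · have hlog : Tendsto (fun x : EuclideanSpace ℝ (Fin n) => Real.log ‖x‖)
        (Bornology.cobounded _) atTop := Real.tendsto_log_atTop.comp tendsto_norm_cobounded_atTop
    have hpos : ∀ᶠ x : EuclideanSpace ℝ (Fin n) in Bornology.cobounded _, 0 < ‖x‖ :=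
      tendsto_norm_cobounded_atTop.eventually_gt_atTop 0
    refine isLittleO_of_tendsto' ?_ ?_
    · filter_upwards [hpos] with x hx h0
      exact absurd h0 (Real.rpow_pos_of_pos hx _).ne'
    · have h2 := (h.comp hlog).sub_const B
      rw [sub_self] at h2
      refine h2.congr' ?_
      filter_upwards [hpos] with x hx
      have hr : 0 < ‖x‖ ^ γ := Real.rpow_pos_of_pos hx _
      rw [Function.comp_apply, mul_comm γ, Real.exp_mul, Real.exp_log hx, Real.rpow_neg hx.le]
      field_simp
  · have hx' : 0 < ‖x‖ := norm_pos_iff.mpr hx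
    have hgx : g (Real.exp (Real.log ‖x‖) • ω) = g x := by
      refine hrad _ _ (smul_ne_zero (Real.exp_pos _).ne' hω0) hx ?_
      rw [norm_smul, hω, Real.norm_of_nonneg (Real.exp_pos _).le, mul_one, Real.exp_log hx']
    have hU : 0 < C ^ (1 / (1 - m)) := Real.rpow_pos_of_pos hC _
    have hpow : (‖x‖ ^ 2) ^ (1 / (1 - m)) = Real.exp (2 / (1 - m) * Real.log ‖x‖) := by
      rw [Real.rpow_def_of_pos (by positivity), Real.log_pow]
      congr 1
      push_cast
      ring
    have hE := Real.exp_pos (2 / (1 - m) * Real.log ‖x‖)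
    rw [Real.div_rpow hC.le (by positivity), hpow]
    simp only [profile, hgx]
    field_simp
    ring

end FastDiffusion

end

open FastDiffusion in
theorem theorem1p4 (n : ℕ) (hn : 3 ≤ n) (m : ℝ) (hm0 : 0 < m)
    (hm1 : m < ((n : ℝ) - 2) / n) :
    ∃ κ : ℝ, 0 < κ ∧ ∀ ρ₁ : ℝ, 0 < ρ₁ → ∃ β₂ : ℝ, β₂ = κ * ρ₁ ∧
      max (FastDiffusion.beta0 n m ρ₁) (FastDiffusion.beta1 n m ρ₁) ≤ β₂ ∧
      ∀ lam : ℝ, 0 < lam → ∀ β : ℝ, β₂ < β →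
        ∀ g : EuclideanSpace ℝ (Fin n) → ℝ,
          FastDiffusion.IsSingularSolution m ρ₁ lam β g →
          ∃ B : ℝ, 0 < B ∧ ∃ e : EuclideanSpace ℝ (Fin n) → ℝ,
            e =o[Bornology.cobounded (EuclideanSpace ℝ (Fin n))]
              (fun x => ‖x‖ ^ (-FastDiffusion.gamma1 n m ρ₁ β)) ∧
            ∀ x : EuclideanSpace ℝ (Fin n), x ≠ 0 →
              g x = (FastDiffusion.Cstar n m ρ₁ / ‖x‖ ^ 2) ^ (1 / (1 - m)) *
                (1 + B * ‖x‖ ^ (-FastDiffusion.gamma1 n m ρ₁ β) + e x) := by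
  have hn' : (3 : ℝ) ≤ n := by exact_mod_cast hn
  have hn0 : (0 : ℝ) < n := by linarith
  have hN0 : 0 < (n : ℝ) - 2 - n * m := by
    rw [lt_div_iff₀ hn0] at hm1
    linarith
  have hm : m < 1 := hm1.trans (by rw [div_lt_one hn0]; linarith)
  have h1m : 0 < 1 - m := by linarith
  set N : ℝ := (n : ℝ) - 2 - n * m with hN
  set a : ℝ := (n - 2 - (n + 2) * m) / (1 - m) with ha
  set b : ℝ := 2 * m * N / (1 - m) ^ 2 with hb
  set μ : ℝ := 1 / m - 1 with hμ
  have hb0 : 0 < b := by positivity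
  have hμ0 : 0 < μ := by
    rw [hμ, sub_pos, lt_div_iff₀ hm0]; linarith
  have hbμ : b * μ = 2 * N / (1 - m) := by
    rw [hb, hμ]; field_simp
  -- The last entry makes the friction `d = 2 β N / (ρ₁ (1 - m))` exceed `6 + |a| + b (μ + 2)`.
  let κ : ℝ := max (max (beta0 n m 1) (beta1 n m 1))
    ((6 + |a| + b * (μ + 2)) * (1 - m) / (2 * N))
  have hκ : 0 < κ := lt_max_of_lt_right (by positivity)
  refine ⟨κ, hκ, fun ρ hρ => ⟨_, rfl, ?_, fun lam hlam β hβ g hg => ?_⟩⟩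
  · rw [beta0_eq_mul, beta1_eq_mul, ← max_mul_of_nonneg _ _ hρ.le]
    exact mul_le_mul_of_nonneg_right (le_max_left _ _) hρ.le
  have hβ0 : 0 < β := (mul_pos hκ hρ).trans hβ
  set d : ℝ := 2 * β * N / (ρ * (1 - m)) with hd
  have hd1 : 6 + |a| + b * (μ + 2) ≤ d := by
    have h1 : (6 + |a| + b * (μ + 2)) * (1 - m) / (2 * N) * ρ ≤ β :=
      (mul_le_mul_of_nonneg_right (le_max_right _ _) hρ.le).trans hβ.le
    rw [div_mul_eq_mul_div, div_le_iff₀ (by positivity)] at h1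
    rw [hd, le_div_iff₀ (by positivity)]
    linarith
  have hd0 : 0 < d := by positivity
  have hA : A n m ρ β / (1 - m) = a + d := by
    rw [A, ha, hd, hN]
    field_simp
  have hdisc : 8 * N * (1 - m) ≤ A n m ρ β ^ 2 := by
    have h1 : A n m ρ β = (a + d) * (1 - m) := by rw [← hA]; field_simp
    have h2 : 8 * N * (1 - m) = 4 * (b * μ) * (1 - m) ^ 2 := by
      rw [hbμ]; field_simp; ring
    have hbμ0 : 0 < b * μ := mul_pos hb0 hμ0
    have h3 : 6 + b * μ ≤ a + d := by linarith [neg_abs_le a]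
    rw [h1, h2, mul_pow]
    refine mul_le_mul_of_nonneg_right ?_ (sq_nonneg _)
    nlinarith
  obtain ⟨hroot, hle⟩ := gamma1_isRoot hm hdisc
  rw [hA, ← hN, ← hbμ] at hroot
  rw [hA] at hle
  have hω : ‖EuclideanSpace.single (⟨0, by omega⟩ : Fin n) (1 : ℝ)‖ = 1 := by simp
  set ω := EuclideanSpace.single (⟨0, by omega⟩ : Fin n) (1 : ℝ)
  have hω0 : ω ≠ 0 := by
    rw [← norm_pos_iff, hω]; exact one_pos
  have hGpos : ∀ s : ℝ, 0 < g (Real.exp s • ω) := fun s =>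
    hg.solution.pos _ (smul_ne_zero (Real.exp_pos s).ne' hω0)
  have hC : 0 < Cstar n m ρ := by
    rw [Cstar]; positivity
  obtain ⟨G', P₁, P₂, hG', hP, hP₁, hode⟩ := hg.solution.ode hg.radial hω
  obtain ⟨p, hp⟩ := exists_isOrbit hm0 hm hρ hN hN0 hGpos hG' hP hP₁ hode
  obtain ⟨K, hK, hlim⟩ := hg.tendsto_profile_rpow hm hβ0 hC hlam hω
  rw [show m * ρ / ((1 - m) * β) = b / d by rw [hb, hd]; field_simp] at hlim
  obtain ⟨hf1, B, hB, hfB⟩ := hp.exists_tendsto hμ0 hb0 hd1 hroot hle hK hlim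
  refine ⟨1 / m * B, by positivity,
    exists_expansion_of_tendsto_profile hm hC hg.radial hω ?_⟩
  refine (tendsto_rpow_sub_one_mul (r := 1 / m) hf1 hfB).congr fun s => ?_
  rw [← Real.rpow_mul (profile_pos (C := 2 * m * N / ((1 - m) * ρ)) hC hGpos s).le,
    mul_one_div_cancel hm0.ne', Real.rpow_one]
  rfl
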